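/- Let $\varphi:\mathbb{R}^n\to(-\infty,\infty]$ be proper (not identically $\infty$), lower semicontinuous and weakly convex, let $\kappa>0$, and let $\|\cdot\|$ and $\langle\cdot,\cdot\rangle$ be the Euclidean norm and inner product. Definitions. For $s\in\mathbb{R}$, $\varphi$ is $s$-convex if $$\varphi((1-\lambda)x+\lambda y)\le(1-\lambda)\varphi(x)+\lambda\varphi(y)-\tfrac{s}{2}\lambda(1-\lambda)\|x-y\|^2\quad\text{for all }x,y\in\mathbb{R}^n,\ \lambda\in(0,1);$$ it is strongly convex with modulus $\kappa$ if it is $\kappa$-convex, and weakly convex if it is $(-\rho)$-convex for some $\rho>0$. For $\Omega\subset\mathbb{R}^m$ and $\bar z\in\Omega$, the regular normal cone is $\widehat N_\Omega(\bar z)=\{v:\limsup_{z\to\bar z,\,z\in\Omega\setminus\{\bar z\}}\langle v,z-\bar z\rangle/\|z-\bar z\|\le 0\}$, and the limiting normal cone $N_\Omega(\bar z)$ consists of all limits $v=\lim v_k$ with $v_k\in\widehat N_\Omega(z_k)$, $z_k\in\Omega$, $z_k\to\bar z$. The limiting subdifferential is $\partial\varphi(x)=\{v:(v,-1)\in N_{\operatorname{epi}\varphi}(x,\varphi(x))\}$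 if $\varphi(x)<\infty$, where $\operatorname{epi}\varphi=\{(x,\alpha)\in\mathbb{R}^{n+1}:\varphi(x)\le\alpha\}$, and $\partial\varphi(x)=\emptyset$ otherwise; $\operatorname{gph}\partial\varphi=\{(x,v):v\in\partial\varphi(x)\}$. For $\varphi(x)<\infty$, $v\in\mathbb{R}^n$ and $\tau>0$ put $$\Delta_\tau^2\varphi(x,v)(u)=\frac{\varphi(x+\tau u)-\varphi(x)-\tau\langle v,u\rangle}{\frac12\tau^2},\qquad d^2\varphi(x,v)(w)=\liminf_{\tau\downarrow0,\;u\to w}\Delta^2_\tau\varphi(x,v)(u)\in[-\infty,\infty].$$ $\varphi$ is twice epi-differentiable at $x$ for $v$ if for every $w\in\mathbb{R}^n$ and every sequence $\tau_k>0$ with $\tau_k\to0$ there is a sequence $w_k\to w$ with $\Delta^2_{\tau_k}\varphi(x,v)(w_k)\to d^2\varphi(x,v)(w)$. It is generalized twice differentiable at $x$ for $v$ if it is twice epi-differentiable at $x$ for $v$ and there are a symmetric matrix $A\in\mathbb{R}^{n\times n}$ and a linear subspace $L\subset\mathbb{R}^n$ such that $d^2\varphi(x,v)(w)=\langle w,Aw\rangle$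 for $w\in L$ and $d^2\varphi(x,v)(w)=\infty$ for $w\notin L$. Corollary (strong convexity via second subderivatives). The following assertions are equivalent: (i) $\varphi$ is strongly convex with modulus $\kappa$; (ii) $d^2\varphi(x,v)(w)\ge\kappa\|w\|^2$ for all $w\in\mathbb{R}^n$ and all $(x,v)\in\operatorname{gph}\partial\varphi$; (iii) $d^2\varphi(x,v)(w)\ge\kappa\|w\|^2$ for all $w\in\mathbb{R}^n$ and all $(x,v)\in\operatorname{gph}\partial\varphi$ such that $\varphi$ is twice epi-differentiable at $x$ for $v$; (iv) $d^2\varphi(x,v)(w)\ge\kappa\|w\|^2$ for all $w\in\mathbb{R}^n$ and all $(x,v)\in\operatorname{gph}\partial\varphi$ such that $\varphi$ is generalized twice differentiable at $x$ for $v$. -/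

import Mathlib

open Filter Topology

noncomputable section

namespace VarAnalysis

/-- Euclidean space of dimension `n`. -/
abbrev Euc (n : ℕ) : Type := EuclideanSpace ℝ (Fin n)

/-- The product `ℝⁿ × ℝ = ℝⁿ⁺¹` with its Euclidean structure. -/
abbrev EucProd (n : ℕ) : Type := WithLp 2 (Euc n × ℝ)

section Cones

variable {E : Type*} [NormedAddCommGroup E] [InnerProductSpace ℝ E]

/-- The regular (Fréchet) normal cone to `Ω` at `z`:
`{v | limsup_{y → z, y ∈ Ω} ⟪v, y - z⟫ / ‖y - z‖ ≤ 0}`, empty if `z ∉ Ω`.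
The upper limit is taken in the extended reals, over `y ≠ z`. -/
def regularNormalCone (Ω : Set E) (z : E) : Set E :=
  {v | z ∈ Ω ∧
    limsup (fun y : E => ((inner ℝ v (y - z) / ‖y - z‖ : ℝ) : EReal)) (𝓝[Ω \ {z}] z) ≤ 0}

/-- The limiting (Mordukhovich) normal cone to `Ω` at `z`, empty if `z ∉ Ω`. -/
def limitingNormalCone (Ω : Set E) (z : E) : Set E :=
  {v | z ∈ Ω ∧ ∃ (zk : ℕ → E) (vk : ℕ → E),
    (∀ k, zk k ∈ Ω) ∧ Tendsto zk atTop (𝓝 z) ∧ Tendsto vk atTop (𝓝 v) ∧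
    ∀ k, vk k ∈ regularNormalCone Ω (zk k)}

end Cones

variable {n : ℕ}

/-- A function is proper if it never takes the value `-∞` and is finite somewhere. -/
def Proper (φ : Euc n → EReal) : Prop :=
  (∀ x, φ x ≠ ⊥) ∧ ∃ x, φ x ≠ ⊤

/-- The epigraph `{(x, α) | φ x ≤ α}` as a subset of `ℝⁿ⁺¹`. -/
def epigraph (φ : Euc n → EReal) : Set (EucProd n) :=
  {z | φ z.fst ≤ (z.snd : EReal)}

/-- The limiting subdifferential: `v ∈ ∂φ(x)` iff `x ∈ dom φ` and `(v, -1)` belongs to the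
limiting normal cone to the epigraph of `φ` at `(x, φ x)`. -/
def limitingSubdifferential (φ : Euc n → EReal) (x : Euc n) : Set (Euc n) :=
  {v | φ x < ⊤ ∧
    (WithLp.toLp 2 (v, (-1 : ℝ)) : EucProd n) ∈
      limitingNormalCone (epigraph φ) (WithLp.toLp 2 (x, (φ x).toReal))}

/-- `φ` is `s`-convex on `Ω`. (For `φ` not taking the value `-∞` no indeterminate
expression occurs.) -/
def SConvexOn (s : ℝ) (Ω : Set (Euc n)) (φ : Euc n → EReal) : Prop :=
  ∀ x ∈ Ω, ∀ y ∈ Ω, ∀ t : ℝ, 0 < t → t < 1 →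
    φ ((1 - t) • x + t • y) ≤
      ((1 - t : ℝ) : EReal) * φ x + (t : EReal) * φ y
        - ((s / 2 * t * (1 - t) * ‖x - y‖ ^ 2 : ℝ) : EReal)

/-- `φ` is strongly convex with modulus `κ` (to be used with `κ > 0`). -/
def StronglyConvex (κ : ℝ) (φ : Euc n → EReal) : Prop :=
  SConvexOn κ Set.univ φ

/-- `φ` is weakly convex: `ρ`-weakly convex for some `ρ > 0`. -/
def WeaklyConvex (φ : Euc n → EReal) : Prop :=
  ∃ ρ : ℝ, 0 < ρ ∧ SConvexOn (-ρ) Set.univ φ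

/-- The second-order difference quotient
`Δ²_τ φ(x, v)(u) = (φ(x + τ u) - φ(x) - τ ⟨v, u⟩) / (τ² / 2)`. -/
def secondQuotient (φ : Euc n → EReal) (x v : Euc n) (τ : ℝ) (u : Euc n) : EReal :=
  (φ (x + τ • u) - φ x - ((τ * inner ℝ v u : ℝ) : EReal)) / ((1 / 2 * τ ^ 2 : ℝ) : EReal)

/-- The second subderivative
`d²φ(x, v)(w) = liminf_{τ ↓ 0, u → w} Δ²_τ φ(x, v)(u)`. -/
def secondSubderivative (φ : Euc n → EReal) (x v w : Euc n) : EReal :=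
  liminf (fun p : ℝ × Euc n => secondQuotient φ x v p.1 p.2) (𝓝[>] (0 : ℝ) ×ˢ 𝓝 w)

/-- Twice epi-differentiability of `φ` at `x` for `v`. -/
def TwiceEpiDifferentiableAt (φ : Euc n → EReal) (x v : Euc n) : Prop :=
  ∀ (w : Euc n) (τ : ℕ → ℝ), (∀ k, 0 < τ k) → Tendsto τ atTop (𝓝 0) →
    ∃ wk : ℕ → Euc n, Tendsto wk atTop (𝓝 w) ∧
      Tendsto (fun k => secondQuotient φ x v (τ k) (wk k)) atTop
        (𝓝 (secondSubderivative φ x v w))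

open Classical in
/-- The indicator function of a set: `0` on it and `∞` off it. -/
def indicatorFun (L : Set (Euc n)) (w : Euc n) : EReal :=
  if w ∈ L then 0 else ⊤

/-- A generalized quadratic form: `q_A + δ_L` with `A` a symmetric matrix, `L` a linear
subspace, and `q_A(w) = ⟨w, A w⟩`. -/
def IsGeneralizedQuadraticForm (q : Euc n → EReal) : Prop :=
  ∃ (A : Matrix (Fin n) (Fin n) ℝ) (L : Submodule ℝ (Euc n)), A.IsSymm ∧
    ∀ w, q w = ((inner ℝ w (A.toEuclideanLin w) : ℝ) : EReal)
      + indicatorFun (L : Set (Euc n)) w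

/-- Generalized twice differentiability of `φ` at `x` for `v`. -/
def GeneralizedTwiceDifferentiableAt (φ : Euc n → EReal) (x v : Euc n) : Prop :=
  TwiceEpiDifferentiableAt φ x v ∧ IsGeneralizedQuadraticForm (secondSubderivative φ x v)

end VarAnalysis

end

noncomputable section

namespace VarAnalysis

variable {n : ℕ}

/-! Going from strong convexity to the bounds on `d²φ` is direct: the epigraph is convex, so
limiting subgradients are global ones with modulus `κ`, and the quadratic minorant passes through
the difference quotients. The substance is the way back from generalized twice differentiability,
and it runs by duality. If `φ` is `(-ρ)`-convex and `α = ρ + 1`, then `φ + (α/2)‖·‖²` is strongly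
convex with modulus 1. Its conjugate `G` is differentiable, and the gradient `p` is nonexpansive,
hence differentiable almost everywhere by Rademacher.

Where `P = Dp(z)` exists, `φ` is generalized twice differentiable at `p z` for `z - α p z`: `d²φ`
equals `⟨P h, h⟩ - α‖P h‖²` at `P h` and `∞` off the range of `P` (`secondSubderivative_apply`,
`secondSubderivative_eq_top`). The assumed bound then gives `(α + κ)‖P h‖² ≤ ⟨P h, h⟩`, so `⟨P h, h⟩
≤ ‖h‖²/(α + κ)`. Fubini and integration along lines make this a global quadratic upper bound on `G`
(`proxConjugate_add_le`). Conjugation turns it into minorants of `φ` with curvature `κ` at all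
proximal subgradients, and proximal approximation of points then yields `κ`-convexity
(`SConvexOn.of_hasQuadraticMinorant`). -/

theorem Proper.coe_toReal {φ : Euc n → EReal} (hφ : Proper φ) {x : Euc n} (hx : φ x ≠ ⊤) :
    ((φ x).toReal : EReal) = φ x :=
  EReal.coe_toReal hx (hφ.1 x)

theorem norm_segment_sq (x y : Euc n) (t : ℝ) :
    ‖(1 - t) • x + t • y‖ ^ 2 =
      (1 - t) * ‖x‖ ^ 2 + t * ‖y‖ ^ 2 - t * (1 - t) * ‖x - y‖ ^ 2 := by
  simp only [← real_inner_self_eq_norm_sq, inner_add_left, inner_add_right, inner_sub_left,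
    inner_sub_right, real_inner_smul_left, real_inner_smul_right, real_inner_comm y x]
  ring

/-- On the effective domain, `s`-convexity is an inequality between real numbers. -/
theorem SConvexOn.toReal_le {φ : Euc n → EReal} {s : ℝ} (hφ : Proper φ)
    (hs : SConvexOn s Set.univ φ) {x y : Euc n} (hx : φ x ≠ ⊤) (hy : φ y ≠ ⊤) {t : ℝ}
    (ht0 : 0 < t) (ht1 : t < 1) :
    φ ((1 - t) • x + t • y) ≠ ⊤ ∧
      (φ ((1 - t) • x + t • y)).toReal ≤ (1 - t) * (φ x).toReal + t * (φ y).toReal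
        - s / 2 * t * (1 - t) * ‖x - y‖ ^ 2 := by
  have h := hs x trivial y trivial t ht0 ht1
  rw [← hφ.coe_toReal hx, ← hφ.coe_toReal hy] at h
  norm_cast at h
  have htop : φ ((1 - t) • x + t • y) ≠ ⊤ := ne_top_of_le_ne_top (EReal.coe_ne_top _) h
  refine ⟨htop, ?_⟩
  rw [← hφ.coe_toReal htop] at h
  exact_mod_cast h

/-- Conversely, the real inequality on the effective domain yields `s`-convexity. -/
theorem sConvexOn_of_forall_le {φ : Euc n → EReal} {s : ℝ} (hφ : Proper φ)
    (h : ∀ x y : Euc n, φ x ≠ ⊤ → φ y ≠ ⊤ → ∀ t : ℝ, 0 < t → t < 1 →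
      φ ((1 - t) • x + t • y) ≤ (((1 - t) * (φ x).toReal + t * (φ y).toReal
        - s / 2 * t * (1 - t) * ‖x - y‖ ^ 2 : ℝ) : EReal)) :
    SConvexOn s Set.univ φ := by
  intro x _ y _ t ht0 ht1
  have hmul : ∀ (r : ℝ), 0 < r → ∀ z, (r : EReal) * φ z ≠ ⊥ := by
    intro r hr z
    induction hz : φ z with
    | bot => exact absurd hz (hφ.1 z)
    | top => rw [EReal.coe_mul_top_of_pos hr]; exact top_ne_bot
    | coe a => exact_mod_cast EReal.coe_ne_bot (r * a)
  have h1 : 0 < 1 - t := by linarith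
  by_cases hx : φ x = ⊤
  · rw [hx, EReal.coe_mul_top_of_pos h1, EReal.top_add_of_ne_bot (hmul t ht0 y), EReal.top_sub_coe]
    exact le_top
  by_cases hy : φ y = ⊤
  · rw [hy, EReal.coe_mul_top_of_pos ht0, EReal.add_top_of_ne_bot (hmul _ h1 x),
      EReal.top_sub_coe]
    exact le_top
  have := h x y hx hy t ht0 ht1
  rw [EReal.coe_sub, EReal.coe_add, EReal.coe_mul, EReal.coe_mul, hφ.coe_toReal hx,
    hφ.coe_toReal hy] at this
  exact this

/-! ### Existence of proximal points -/

/-- A lower semicontinuous, proper, `s`-convex function with `s > 0` has a global minimizer, at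
which it grows quadratically. -/
theorem SConvexOn.exists_forall_quadratic_growth {H : Euc n → EReal} {s : ℝ} (hs : 0 < s)
    (hH : Proper H) (hlsc : LowerSemicontinuous H) (hconv : SConvexOn s Set.univ H) :
    ∃ x, H x ≠ ⊤ ∧ ∀ y, H y ≠ ⊤ → (H x).toReal + s / 2 * ‖y - x‖ ^ 2 ≤ (H y).toReal := by
  obtain ⟨x₀, hx₀⟩ := hH.2
  obtain ⟨m, hm, hmin⟩ := (hlsc.lowerSemicontinuousOn (Metric.closedBall x₀ 1)).exists_isMinOn
    ⟨x₀, by simp⟩ (isCompact_closedBall x₀ 1)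
  have hm0 : H m ≠ ⊤ := ne_top_of_le_ne_top hx₀ (hmin (by simp))
  have hreal : ∀ {a b : Euc n}, H b ≠ ⊤ → H a ≤ H b → (H a).toReal ≤ (H b).toReal :=
    fun {a b} hb hab => EReal.toReal_le_toReal hab (hH.1 a) hb
  have hmx : (H m).toReal ≤ (H x₀).toReal := hreal hx₀ (hmin (by simp))
  -- Beyond distance `R` from `x₀`, the strong convexity term outweighs the possible drop from `H
  -- x₀` to `H m`, so a minimizer over the `R`-ball is global.
  set R : ℝ := 1 + 2 * ((H x₀).toReal - (H m).toReal) / s with hR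
  have hR1 : 1 ≤ R := by
    have : 0 ≤ 2 * ((H x₀).toReal - (H m).toReal) / s := by
      apply div_nonneg _ hs.le; linarith
    linarith
  obtain ⟨x, hx, hxmin⟩ := (hlsc.lowerSemicontinuousOn (Metric.closedBall x₀ R)).exists_isMinOn
    ⟨x₀, by simp; linarith⟩ (isCompact_closedBall x₀ R)
  have hxx₀ : H x ≤ H x₀ := hxmin (by simp; linarith)
  have hxtop : H x ≠ ⊤ := ne_top_of_le_ne_top hx₀ hxx₀
  have hglobal : ∀ y, H y ≠ ⊤ → (H x).toReal ≤ (H y).toReal := by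
    intro y hy
    by_cases hyR : y ∈ Metric.closedBall x₀ R
    · exact hreal hy (hxmin hyR)
    refine (hreal hx₀ hxx₀).trans ?_
    set r := ‖x₀ - y‖ with hr
    have hrR : R < r := by
      rw [Metric.mem_closedBall, dist_comm, dist_eq_norm] at hyR
      exact not_le.1 hyR
    have hr0 : 0 < r := by linarith
    -- The weight `1 / r` gives the point of the segment at distance one from `x₀`, where `H` is at
    -- least `H m`.
    obtain ⟨hb, hle⟩ := hconv.toReal_le hH hx₀ hy (t := 1 / r) (by positivity)
      (by rw [div_lt_one hr0]; linarith)
    have hmem : (1 - 1 / r) • x₀ + (1 / r) • y ∈ Metric.closedBall x₀ 1 := by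
      have : (1 - 1 / r) • x₀ + (1 / r) • y - x₀ = (1 / r) • (y - x₀) := by module
      rw [Metric.mem_closedBall, dist_eq_norm, this, norm_smul, norm_sub_rev, ← hr]
      simp [abs_of_pos hr0, hr0.ne']
    have h1 := (hreal hb (hmin hmem)).trans hle
    have h2 : 2 * ((H x₀).toReal - (H m).toReal) ≤ s * (r - 1) := by
      have : 2 * ((H x₀).toReal - (H m).toReal) / s ≤ r - 1 := by linarith
      rw [div_le_iff₀ hs] at this
      linarith
    rw [← hr] at h1
    have h3 : r * (H m).toReal ≤ (r - 1) * (H x₀).toReal + (H y).toReal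
        - s / 2 * (r - 1) * r := by
      have := mul_le_mul_of_nonneg_left h1 hr0.le
      field_simp at this
      linarith
    nlinarith
  refine ⟨x, hxtop, fun y hy => ?_⟩
  -- Minimality against `(1 - t) x + t y`, divided by `t`, gives growth with the factor `1 - t`;
  -- then `t ↓ 0`.
  have hlim : Tendsto (fun t : ℝ => (H x).toReal + s / 2 * (1 - t) * ‖y - x‖ ^ 2) (𝓝[>] 0)
      (𝓝 ((H x).toReal + s / 2 * (1 - 0) * ‖y - x‖ ^ 2)) :=
    Tendsto.mono_left (Continuous.tendsto (by fun_prop) 0) nhdsWithin_le_nhds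
  rw [sub_zero, mul_one] at hlim
  refine le_of_tendsto hlim ?_
  filter_upwards [Ioo_mem_nhdsGT (zero_lt_one' ℝ)] with t ht
  obtain ⟨hb, hle⟩ := hconv.toReal_le hH hxtop hy ht.1 ht.2
  have := (hglobal _ hb).trans hle
  rw [norm_sub_rev] at this
  have h2 : t * ((H x).toReal + s / 2 * (1 - t) * ‖y - x‖ ^ 2) ≤ t * (H y).toReal := by
    linarith
  exact le_of_mul_le_mul_left h2 ht.1

/-- `φ` is minorized by the quadratic function with value `φ x`, slope `v` at `x` and
curvature `σ`. -/
def HasQuadraticMinorant (σ : ℝ) (φ : Euc n → EReal) (x v : Euc n) : Prop :=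
  φ x ≠ ⊤ ∧ ∀ y, φ y ≠ ⊤ →
    (φ x).toReal + inner ℝ v (y - x) + σ / 2 * ‖y - x‖ ^ 2 ≤ (φ y).toReal

/-- Proximal points of a weakly convex function exist. -/
theorem SConvexOn.exists_hasQuadraticMinorant {φ : Euc n → EReal} {s : ℝ} (hφ : Proper φ)
    (hlsc : LowerSemicontinuous φ) (hconv : SConvexOn s Set.univ φ) {α : ℝ}
    (hα : 0 < s + α) (b : Euc n) :
    ∃ x, HasQuadraticMinorant s φ x (b - α • x) := by
  set q : Euc n → ℝ := fun y => α / 2 * ‖y‖ ^ 2 - inner ℝ b y with hq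
  have htop : ∀ y, φ y + (q y : EReal) ≠ ⊤ ↔ φ y ≠ ⊤ := fun y =>
    EReal.add_ne_top_iff_ne_top_left (EReal.coe_ne_bot _) (EReal.coe_ne_top _)
  have htr : ∀ y, φ y ≠ ⊤ → (φ y + (q y : EReal)).toReal = (φ y).toReal + q y := by
    intro y hy
    rw [EReal.toReal_add hy (hφ.1 y) (EReal.coe_ne_top _) (EReal.coe_ne_bot _), EReal.toReal_coe]
  have hH : Proper (fun y => φ y + (q y : EReal)) := by
    refine ⟨fun y => ?_, ?_⟩
    · simp [EReal.add_eq_bot_iff, hφ.1 y]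
    · obtain ⟨x₀, hx₀⟩ := hφ.2
      exact ⟨x₀, (htop x₀).2 hx₀⟩
  have hqc : Continuous fun y => (q y : EReal) :=
    continuous_coe_real_ereal.comp (by fun_prop)
  have hHlsc : LowerSemicontinuous (fun y => φ y + (q y : EReal)) :=
    hlsc.add' hqc.lowerSemicontinuous fun y =>
      EReal.continuousAt_add (Or.inr (EReal.coe_ne_bot _)) (Or.inr (EReal.coe_ne_top _))
  have hHconv : SConvexOn (s + α) Set.univ (fun y => φ y + (q y : EReal)) := by
    refine sConvexOn_of_forall_le hH fun x y hx hy t ht0 ht1 => ?_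
    rw [htop] at hx hy
    obtain ⟨hb, hle⟩ := hconv.toReal_le hφ hx hy ht0 ht1
    rw [htr x hx, htr y hy, ← hφ.coe_toReal hb, ← EReal.coe_add, EReal.coe_le_coe_iff]
    have : q ((1 - t) • x + t • y) =
        (1 - t) * q x + t * q y - α / 2 * t * (1 - t) * ‖x - y‖ ^ 2 := by
      simp only [hq]
      rw [norm_segment_sq, inner_add_right, real_inner_smul_right, real_inner_smul_right]
      ring
    rw [this]
    linarith
  obtain ⟨x, hx, hgrow⟩ := hHconv.exists_forall_quadratic_growth hα hH hHlsc
  rw [htop] at hx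
  refine ⟨x, hx, fun y hy => ?_⟩
  have h := hgrow y ((htop y).2 hy)
  rw [htr x hx, htr y hy] at h
  have hid : q x + (s + α) / 2 * ‖y - x‖ ^ 2 - q y =
      inner ℝ (b - α • x) (y - x) + s / 2 * ‖y - x‖ ^ 2 := by
    simp only [hq, ← real_inner_self_eq_norm_sq, inner_sub_left,
      inner_sub_right, real_inner_smul_left, real_inner_comm y x]
    ring
  linarith

/-! ### The proximal map and the conjugate -/

/-- `p z` is the maximizer of `⟨z, ·⟩ - φ - (α / 2) ‖·‖²`, where `φ + (α / 2) ‖·‖²` is strongly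
convex with modulus `1`. -/
def IsProxMap (φ : Euc n → EReal) (α : ℝ) (p : Euc n → Euc n) : Prop :=
  ∀ z, HasQuadraticMinorant (1 - α) φ (p z) (z - α • p z)

/-- The Fenchel conjugate of `φ + (α / 2) ‖·‖²`, expressed through the maximizers `p`. -/
def proxConjugate (φ : Euc n → EReal) (α : ℝ) (p : Euc n → Euc n) (z : Euc n) : ℝ :=
  inner ℝ z (p z) - (φ (p z)).toReal - α / 2 * ‖p z‖ ^ 2

namespace IsProxMap

variable {φ : Euc n → EReal} {α : ℝ} {p : Euc n → Euc n}

/-- The Fenchel–Young inequality; the square is the gain from strong convexity with modulus 1, and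
it vanishes at the maximizer. -/
theorem fenchel_young (hp : IsProxMap φ α p) (z : Euc n) {y : Euc n} (hy : φ y ≠ ⊤) :
    inner ℝ z y - proxConjugate φ α p z + 1 / 2 * ‖y - p z‖ ^ 2 ≤
      (φ y).toReal + α / 2 * ‖y‖ ^ 2 := by
  have h := (hp z).2 y hy
  have hid : inner ℝ (z - α • p z) (y - p z) + (1 - α) / 2 * ‖y - p z‖ ^ 2 =
      inner ℝ z y - inner ℝ z (p z) + α / 2 * ‖p z‖ ^ 2 - α / 2 * ‖y‖ ^ 2
        + 1 / 2 * ‖y - p z‖ ^ 2 := by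
    simp only [← real_inner_self_eq_norm_sq, inner_sub_left,
      inner_sub_right, real_inner_smul_left, real_inner_comm y (p z)]
    ring
  unfold proxConjugate
  linarith

/-- The maximizers are the subgradients of the conjugate. -/
theorem add_inner_le (hp : IsProxMap φ α p) (z z' : Euc n) :
    proxConjugate φ α p z + inner ℝ (p z) (z' - z) + 1 / 2 * ‖p z' - p z‖ ^ 2 ≤
      proxConjugate φ α p z' := by
  have h := hp.fenchel_young z' (hp z).1
  rw [norm_sub_rev (p z)] at h
  have e : proxConjugate φ α p z =
    inner ℝ z (p z) - (φ (p z)).toReal - α / 2 * ‖p z‖ ^ 2 := rfl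
  rw [inner_sub_right, real_inner_comm z' (p z), real_inner_comm z (p z)]
  linarith

/-- Firm nonexpansiveness, from adding the two strengthened subgradient inequalities at `z` and
`z'`. -/
theorem norm_sub_sq_le_inner (hp : IsProxMap φ α p) (z z' : Euc n) :
    ‖p z' - p z‖ ^ 2 ≤ inner ℝ (p z' - p z) (z' - z) := by
  have h1 := hp.add_inner_le z z'
  have h2 := hp.add_inner_le z' z
  rw [norm_sub_rev (p z)] at h2
  have : inner ℝ (p z') (z - z') = - inner ℝ (p z') (z' - z) := by
    rw [← inner_neg_right, neg_sub]
  rw [inner_sub_left]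
  linarith

theorem lipschitzWith (hp : IsProxMap φ α p) : LipschitzWith 1 p := by
  refine LipschitzWith.of_dist_le_mul fun z' z => ?_
  rw [dist_eq_norm, dist_eq_norm, NNReal.coe_one, one_mul]
  have h := (hp.norm_sub_sq_le_inner z z').trans (real_inner_le_norm _ _)
  by_contra! hlt
  have : 0 < ‖p z' - p z‖ := (norm_nonneg _).trans_lt hlt
  nlinarith

/-- The conjugate is differentiable, and its gradient is the map of maximizers. -/
theorem hasFDerivAt_proxConjugate (hp : IsProxMap φ α p) (z : Euc n) :
    HasFDerivAt (proxConjugate φ α p) (innerSL ℝ (p z)) z := by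
  rw [hasFDerivAt_iff_isLittleO]
  -- The subgradient inequality at `z` makes the remainder nonnegative; the one at `z'` bounds it by
  -- `⟨p z' - p z, z' - z⟩ ≤ ‖z' - z‖²`.
  have hO : (fun z' => proxConjugate φ α p z' - proxConjugate φ α p z -
      innerSL ℝ (p z) (z' - z)) =O[𝓝 z] fun z' => ‖z' - z‖ ^ 2 := by
    refine Asymptotics.IsBigO.of_bound 1 (Eventually.of_forall fun z' => ?_)
    rw [innerSL_apply_apply]
    have h1 := hp.add_inner_le z z'
    have h2 := hp.add_inner_le z' z
    have h3 := real_inner_le_norm (p z' - p z) (z' - z)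
    have h4 : ‖p z' - p z‖ ≤ ‖z' - z‖ := by
      simpa [dist_eq_norm] using hp.lipschitzWith.dist_le_mul z' z
    have h5 : inner ℝ (p z') (z - z') = - inner ℝ (p z') (z' - z) := by
      rw [← inner_neg_right, neg_sub]
    rw [inner_sub_left] at h3
    have h6 := sq_nonneg ‖p z' - p z‖
    have h7 := sq_nonneg ‖p z - p z'‖
    have h8 : ‖p z' - p z‖ * ‖z' - z‖ ≤ ‖z' - z‖ ^ 2 := by
      rw [sq]; gcongr
    rw [Real.norm_of_nonneg (by linarith), Real.norm_of_nonneg (by positivity)]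
    linarith
  refine hO.trans_isLittleO ?_
  have := (Asymptotics.isLittleO_pow_id (𝕜 := ℝ) one_lt_two).comp_tendsto
    (show Tendsto (fun z' => ‖z' - z‖) (𝓝 z) (𝓝 0) from
      tendsto_norm_sub_self z)
  exact this.norm_right.congr (fun _ => rfl) (fun _ => by simp) |>.of_norm_right

theorem hasDerivAt_proxConjugate_line (hp : IsProxMap φ α p) (z h : Euc n) (t : ℝ) :
    HasDerivAt (fun s : ℝ => proxConjugate φ α p (z + s • h)) (inner ℝ (p (z + t • h)) h) t := by
  have hl : HasDerivAt (fun s : ℝ => z + s • h) h t := by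
    simpa using ((hasDerivAt_id t).smul_const h).const_add z
  simpa [Function.comp_def] using (hp.hasFDerivAt_proxConjugate (z + t • h)).comp_hasDerivAt t hl

theorem hasDerivAt_line {P : Euc n →L[ℝ] Euc n} {z h : Euc n} {t : ℝ}
    (hP : HasFDerivAt p P (z + t • h)) :
    HasDerivAt (fun s : ℝ => p (z + s • h)) (P h) t := by
  have hl : HasDerivAt (fun s : ℝ => z + s • h) h t := by
    simpa using ((hasDerivAt_id t).smul_const h).const_add z
  exact hP.comp_hasDerivAt t hl

/-- The difference quotients of the map of maximizers converge where it is differentiable. -/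
theorem tendsto_slope {P : Euc n →L[ℝ] Euc n} {z : Euc n} (hP : HasFDerivAt p P z) (h : Euc n) :
    Tendsto (fun τ : ℝ => τ⁻¹ • (p (z + τ • h) - p z)) (𝓝[>] 0) (𝓝 (P h)) := by
  have h0 : HasDerivAt (fun s : ℝ => p (z + s • h)) (P h) 0 :=
    hasDerivAt_line (by simpa using hP)
  simpa using h0.tendsto_slope_zero_right

/-- The second-order expansion of the conjugate where its gradient is differentiable. -/
theorem tendsto_second_quotient (hp : IsProxMap φ α p) {P : Euc n →L[ℝ] Euc n} {z : Euc n}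
    (hP : HasFDerivAt p P z) (h : Euc n) :
    Tendsto (fun τ : ℝ => (proxConjugate φ α p (z + τ • h) - proxConjugate φ α p z
      - τ * inner ℝ (p z) h) / (1 / 2 * τ ^ 2)) (𝓝[>] 0) (𝓝 (inner ℝ (P h) h)) := by
  have hd : ∀ τ : ℝ, HasDerivAt (fun τ : ℝ => proxConjugate φ α p (z + τ • h) -
      proxConjugate φ α p z - τ * inner ℝ (p z) h) (inner ℝ (p (z + τ • h)) h - inner ℝ (p z) h)
      τ := fun τ => by
    simpa using ((hp.hasDerivAt_proxConjugate_line z h τ).sub_const _).fun_sub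
      ((hasDerivAt_id τ).mul_const (inner ℝ (p z) h))
  have hd2 : ∀ τ : ℝ, HasDerivAt (fun τ : ℝ => 1 / 2 * τ ^ 2) τ τ := fun τ => by
    simpa using (hasDerivAt_pow 2 τ).const_mul (1 / 2 : ℝ)
  -- By L'Hôpital the second-order quotient reduces to the first-order quotient of the gradient `p`,
  -- so differentiability of `p` at the single point `z` suffices.
  refine HasDerivAt.lhopital_zero_nhdsGT
    (f' := fun τ => inner ℝ (p (z + τ • h)) h - inner ℝ (p z) h) (g' := fun τ => τ)
    (Eventually.of_forall hd) (Eventually.of_forall hd2) ?_ ?_ ?_ ?_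
  · filter_upwards [self_mem_nhdsWithin] with τ hτ using (ne_of_gt hτ)
  · have := (hd 0).continuousAt.tendsto
    simp only [zero_smul, add_zero, sub_self, zero_mul] at this
    exact this.mono_left nhdsWithin_le_nhds
  · have := (hd2 0).continuousAt.tendsto
    simp only [ne_eq, OfNat.ofNat_ne_zero, not_false_eq_true, zero_pow, mul_zero] at this
    exact this.mono_left nhdsWithin_le_nhds
  · have := (tendsto_slope hP h).inner (𝕜 := ℝ) (tendsto_const_nhds (x := h))
    refine this.congr fun τ => ?_
    rw [real_inner_smul_left, inner_sub_left, div_eq_inv_mul]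

/-- A proximal subgradient of `φ` determines its base point. -/
theorem eq_of_hasQuadraticMinorant (hp : IsProxMap φ α p) {x v : Euc n}
    (h : HasQuadraticMinorant (1 - α) φ x v) : p (v + α • x) = x := by
  set z := v + α • x with hz
  have h1 := hp.fenchel_young z h.1
  have h2 := h.2 (p z) (hp z).1
  have hv : v = z - α • x := by rw [hz]; abel
  rw [hv] at h2
  have hid : inner ℝ (z - α • x) (p z - x) + (1 - α) / 2 * ‖p z - x‖ ^ 2 =
      inner ℝ z (p z) - inner ℝ z x + α / 2 * ‖x‖ ^ 2 - α / 2 * ‖p z‖ ^ 2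
        + 1 / 2 * ‖p z - x‖ ^ 2 := by
    simp only [← real_inner_self_eq_norm_sq, inner_sub_left,
      inner_sub_right, real_inner_smul_left, real_inner_comm (p z) x]
    ring
  unfold proxConjugate at h1
  rw [norm_sub_rev] at h1
  have : ‖p z - x‖ ^ 2 ≤ 0 := by linarith
  have := pow_eq_zero_iff two_ne_zero |>.1 (this.antisymm (sq_nonneg _))
  exact sub_eq_zero.1 (norm_eq_zero.1 this)

end IsProxMap

/-! ### From an almost everywhere Hessian bound to global quadratic bounds -/

/-- A property that holds almost everywhere holds almost everywhere on almost every line of a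
given direction. -/
theorem ae_ae_line {Q : Euc n → Prop} (hQ : ∀ᵐ z, Q z) (h : Euc n) :
    ∀ᵐ z : Euc n, ∀ᵐ t : ℝ, Q (z + t • h) := by
  obtain ⟨N, hN, hmeas, hnull⟩ := MeasureTheory.exists_measurable_superset_of_null hQ
  have hcompl : ∀ z, z ∉ N → Q z := fun z hz => by
    by_contra hz'
    exact hz (hN hz')
  have hmeas' : MeasurableSet {x : ℝ × Euc n | x.2 + x.1 • h ∉ N} :=
    hmeas.compl.preimage (by fun_prop)
  have hline : ∀ᵐ t : ℝ, ∀ᵐ z : Euc n, z + t • h ∉ N := Eventually.of_forall fun t => by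
    have : ∀ᵐ z : Euc n, z ∉ N := MeasureTheory.measure_eq_zero_iff_ae_notMem.1 hnull
    exact (MeasureTheory.measurePreserving_add_right MeasureTheory.volume
      (t • h)).quasiMeasurePreserving.ae this
  have := (MeasureTheory.Measure.ae_ae_comm (p := fun (t : ℝ) (z : Euc n) => z + t • h ∉ N)
    hmeas').1 hline
  filter_upwards [this] with z hz
  filter_upwards [hz] with t ht using hcompl _ ht

/-- A Lipschitz function on the line whose derivative is almost everywhere at most `C` grows with
rate at most `C`. -/
theorem le_add_mul_of_ae_deriv_le {θ : ℝ → ℝ} {K : NNReal} (hθ : LipschitzWith K θ) {C : ℝ}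
    (hC : ∀ᵐ t, deriv θ t ≤ C) {a b : ℝ} (hab : a ≤ b) : θ b ≤ θ a + C * (b - a) := by
  have hac : AbsolutelyContinuousOnInterval θ a b :=
    (hθ.lipschitzOnWith (s := Set.uIcc a b)).absolutelyContinuousOnInterval
  have h1 := intervalIntegral.integral_mono_ae hab hac.intervalIntegrable_deriv
    (intervalIntegrable_const (c := C)) hC
  rw [hac.integral_deriv_eq_sub, intervalIntegral.integral_const, smul_eq_mul] at h1
  linarith

namespace IsProxMap

variable {φ : Euc n → EReal} {α : ℝ} {p : Euc n → Euc n}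

/-- An almost everywhere bound on the second derivative of the conjugate yields a global quadratic
upper bound. -/
theorem proxConjugate_add_le (hp : IsProxMap φ α p) {c : ℝ}
    (hc : ∀ᵐ z, ∃ P : Euc n →L[ℝ] Euc n, HasFDerivAt p P z ∧
      ∀ h, inner ℝ (P h) h ≤ c * ‖h‖ ^ 2) (z h : Euc n) :
    proxConjugate φ α p (z + h) ≤
      proxConjugate φ α p z + inner ℝ (p z) h + c / 2 * ‖h‖ ^ 2 := by
  have hGc : Continuous (proxConjugate φ α p) :=
    continuous_iff_continuousAt.2 fun z => (hp.hasFDerivAt_proxConjugate z).continuousAt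
  have hpc : Continuous p := hp.lipschitzWith.continuous
  -- The inequality is closed in `z`, so it suffices to treat the dense set of `z` for which the
  -- derivative bound holds almost everywhere on the line through `z` along `h`.
  have hdense := MeasureTheory.Measure.dense_of_ae (ae_ae_line hc h)
  have hclosed : IsClosed {z | proxConjugate φ α p (z + h) ≤
      proxConjugate φ α p z + inner ℝ (p z) h + c / 2 * ‖h‖ ^ 2} :=
    isClosed_le (by fun_prop) (by fun_prop)
  refine hclosed.closure_subset_iff.2 (fun z hz => ?_) (hdense z)
  have hθ : LipschitzWith (‖h‖₊ * ‖h‖₊) fun t : ℝ => inner ℝ (p (z + t • h)) h := by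
    refine LipschitzWith.of_dist_le_mul fun s t => ?_
    rw [Real.dist_eq, ← inner_sub_left]
    refine (abs_real_inner_le_norm _ _).trans ?_
    have h1 : ‖p (z + s • h) - p (z + t • h)‖ ≤ ‖(s - t) • h‖ := by
      have := hp.lipschitzWith.dist_le_mul (z + s • h) (z + t • h)
      rwa [dist_eq_norm, dist_eq_norm, NNReal.coe_one, one_mul,
        show z + s • h - (z + t • h) = (s - t) • h by module] at this
    rw [norm_smul, Real.norm_eq_abs] at h1
    rw [Real.dist_eq, NNReal.coe_mul, coe_nnnorm]
    calc _ ≤ (|s - t| * ‖h‖) * ‖h‖ := by gcongr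
      _ = _ := by ring
  have hder : ∀ᵐ t : ℝ, deriv (fun t : ℝ => inner ℝ (p (z + t • h)) h) t ≤ c * ‖h‖ ^ 2 := by
    filter_upwards [hz] with t ⟨P, hP, hPc⟩
    have := (hasDerivAt_line hP).inner ℝ (hasDerivAt_const t h)
    rw [this.deriv]
    simpa using hPc h
  -- The derivative of this gap is `c‖h‖² t - ⟨p (z + t h) - p z, h⟩`, nonnegative by the integrated
  -- bound; compare `t = 0` with `t = 1`.
  have hmono : MonotoneOn (fun t : ℝ => proxConjugate φ α p z + t * inner ℝ (p z) h
      + c / 2 * ‖h‖ ^ 2 * t ^ 2 - proxConjugate φ α p (z + t • h)) (Set.Ici 0) := by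
    have hd : ∀ t : ℝ, HasDerivAt (fun t : ℝ => proxConjugate φ α p z + t * inner ℝ (p z) h
        + c / 2 * ‖h‖ ^ 2 * t ^ 2 - proxConjugate φ α p (z + t • h))
        (inner ℝ (p z) h + c / 2 * ‖h‖ ^ 2 * (2 * t) - inner ℝ (p (z + t • h)) h) t := fun t => by
      simpa using ((((hasDerivAt_id t).mul_const (inner ℝ (p z) h)).const_add
        (proxConjugate φ α p z)).fun_add ((hasDerivAt_pow 2 t).const_mul
          (c / 2 * ‖h‖ ^ 2))).fun_sub (hp.hasDerivAt_proxConjugate_line z h t)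
    refine monotoneOn_of_deriv_nonneg (convex_Ici 0)
      (fun t _ => (hd t).continuousAt.continuousWithinAt)
      (fun t _ => (hd t).differentiableAt.differentiableWithinAt) fun t ht => ?_
    rw [interior_Ici] at ht
    have := le_add_mul_of_ae_deriv_le hθ hder (le_of_lt ht)
    simp only [zero_smul, add_zero, sub_zero] at this
    rw [(hd t).deriv]
    linarith
  have := hmono (Set.mem_Ici.2 le_rfl) (Set.mem_Ici.2 zero_le_one) zero_le_one
  simp only [zero_smul, add_zero, one_smul, zero_mul, one_mul, one_pow, mul_one] at this
  simp only [Set.mem_ofPred_eq]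
  norm_num at this
  linarith

/-- A quadratic upper bound on the conjugate of `φ + (α / 2) ‖·‖²` turns into a quadratic lower
bound on `φ`. -/
theorem hasQuadraticMinorant_of_proxConjugate_le (hp : IsProxMap φ α p) {c : ℝ} (hc : 0 < c)
    (hG : ∀ z h, proxConjugate φ α p (z + h) ≤
      proxConjugate φ α p z + inner ℝ (p z) h + c / 2 * ‖h‖ ^ 2) (z : Euc n) :
    HasQuadraticMinorant (1 / c - α) φ (p z) (z - α • p z) := by
  refine ⟨(hp z).1, fun y hy => ?_⟩
  -- The shift `(y - p z) / c` maximizes `⟨h, y - p z⟩ - (c/2)‖h‖²` over `h`, giving the best lower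
  -- bound.
  have h1 := hp.fenchel_young (z + (1 / c) • (y - p z)) hy
  have h2 := hG z ((1 / c) • (y - p z))
  have h3 : c / 2 * ‖(1 / c) • (y - p z)‖ ^ 2 = 1 / c / 2 * ‖y - p z‖ ^ 2 := by
    rw [norm_smul, mul_pow, Real.norm_eq_abs, sq_abs]
    field_simp
  have h4 := sq_nonneg ‖y - p (z + (1 / c) • (y - p z))‖
  have e : proxConjugate φ α p z =
    inner ℝ z (p z) - (φ (p z)).toReal - α / 2 * ‖p z‖ ^ 2 := rfl
  rw [h3] at h2
  have hid : inner ℝ (z + (1 / c) • (y - p z)) y - inner ℝ (p z) ((1 / c) • (y - p z))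
      - 1 / c / 2 * ‖y - p z‖ ^ 2 - α / 2 * ‖y‖ ^ 2 - inner ℝ z (p z) + α / 2 * ‖p z‖ ^ 2 =
      inner ℝ (z - α • p z) (y - p z) + (1 / c - α) / 2 * ‖y - p z‖ ^ 2 := by
    simp only [← real_inner_self_eq_norm_sq, inner_sub_left, inner_add_left,
      inner_sub_right, real_inner_smul_left, real_inner_smul_right, real_inner_comm y (p z)]
    ring
  linarith

end IsProxMap

/-! ### From quadratic minorants to convexity -/

/-- If all proximal subgradients improve to modulus `κ`, then the function is `κ`-convex. -/
theorem SConvexOn.of_hasQuadraticMinorant {φ : Euc n → EReal} {s κ : ℝ} (hφ : Proper φ)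
    (hlsc : LowerSemicontinuous φ) (hconv : SConvexOn s Set.univ φ) (hκ : 0 ≤ κ)
    (h : ∀ x v, HasQuadraticMinorant s φ x v → HasQuadraticMinorant κ φ x v) :
    SConvexOn κ Set.univ φ := by
  refine sConvexOn_of_forall_le hφ fun x y hx hy t ht0 ht1 => ?_
  set a := (1 - t) • x + t • y with ha
  have hatop : φ a ≠ ⊤ := (hconv.toReal_le hφ hx hy ht0 ht1).1
  have hmin : ∀ β : ℝ, 0 < s + β → ∃ u, HasQuadraticMinorant κ φ u (β • (a - u)) := by
    intro β hβ
    obtain ⟨u, hu⟩ := hconv.exists_hasQuadraticMinorant hφ hlsc hβ (β • a)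
    exact ⟨u, h _ _ (by rwa [smul_sub])⟩
  have hs : 0 < s + (|s| + 1) := by linarith [neg_abs_le s]
  obtain ⟨u₀, hu₀⟩ := hmin _ hs
  set B := ‖(|s| + 1) • (a - u₀)‖ with hB
  have hB0 : 0 ≤ B := norm_nonneg _
  -- Proximal points of `a` with growing parameters. The summand `B` absorbs the linear lower bound
  -- on `φ` supplied by the fixed minorant at `u₀`, leaving `k‖a - u k‖²` bounded.
  have hex : ∀ k : ℕ, ∃ u, HasQuadraticMinorant κ φ u ((|s| + 1 + B + k) • (a - u)) :=
    fun k => hmin _ (by linarith [k.cast_nonneg (α := ℝ)])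
  choose u hu using hex
  set A := (φ a).toReal - (φ u₀).toReal + B * ‖a - u₀‖ + B with hA
  have hbound : ∀ k : ℕ, k * ‖a - u k‖ ^ 2 ≤ A := by
    intro k
    have h1 := (hu k).2 a hatop
    rw [real_inner_smul_left, real_inner_self_eq_norm_sq] at h1
    have h2 := hu₀.2 (u k) (hu k).1
    have h3 := (abs_le.1 (abs_real_inner_le_norm ((|s| + 1) • (a - u₀)) (u k - u₀))).1
    rw [← hB] at h3
    have h4 : ‖u k - u₀‖ ≤ ‖a - u k‖ + ‖a - u₀‖ := by
      rw [norm_sub_rev a (u k)]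
      exact norm_sub_le_norm_sub_add_norm_sub _ _ _
    have h5 := mul_le_mul_of_nonneg_left h4 hB0
    have h6 : B * ‖a - u k‖ ≤ B * (1 + ‖a - u k‖ ^ 2) :=
      mul_le_mul_of_nonneg_left (by nlinarith [sq_nonneg (‖a - u k‖ - 1)]) hB0
    have h7 : 0 ≤ κ / 2 * ‖a - u k‖ ^ 2 := by positivity
    have h8 : 0 ≤ κ / 2 * ‖u k - u₀‖ ^ 2 := by positivity
    have h9 : 0 ≤ (|s| + 1) * ‖a - u k‖ ^ 2 := by positivity
    linarith
  have hlim : Tendsto u atTop (𝓝 a) := by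
    rw [tendsto_iff_norm_sub_tendsto_zero]
    have hsq : Tendsto (fun k => ‖u k - a‖ ^ 2) atTop (𝓝 0) := by
      refine squeeze_zero' (Eventually.of_forall fun k => by positivity) ?_
        (tendsto_const_div_atTop_nhds_zero_nat A)
      filter_upwards [eventually_gt_atTop 0] with k hk
      have hk' : (0 : ℝ) < k := by exact_mod_cast hk
      rw [le_div_iff₀ hk', mul_comm, norm_sub_rev]
      exact hbound k
    simpa using hsq.sqrt
  -- By lower semicontinuity it suffices to bound `φ (u k)`. Averaging the minorants at `x` and `y`,
  -- the linear part becomes a nonnegative multiple of `‖a - u k‖²` and can be dropped.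
  refine (hlsc.isClosed_preimage _).mem_of_tendsto hlim (Eventually.of_forall fun k => ?_)
  rw [Set.mem_preimage, Set.mem_Iic, ← hφ.coe_toReal (hu k).1, EReal.coe_le_coe_iff]
  have hx' := mul_le_mul_of_nonneg_left ((hu k).2 x hx) (sub_nonneg.2 ht1.le)
  have hy' := mul_le_mul_of_nonneg_left ((hu k).2 y hy) ht0.le
  set v := (|s| + 1 + B + k) • (a - u k) with hv
  have hin : (1 - t) * inner ℝ v (x - u k) + t * inner ℝ v (y - u k) =
      (|s| + 1 + B + k) * ‖a - u k‖ ^ 2 := by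
    rw [← real_inner_smul_right, ← real_inner_smul_right, ← inner_add_right,
      show (1 - t) • (x - u k) + t • (y - u k) = a - u k by rw [ha]; module, hv,
      real_inner_smul_left, real_inner_self_eq_norm_sq]
  have hnn : 0 ≤ (|s| + 1 + B + k) * ‖a - u k‖ ^ 2 := by positivity
  have hseg := norm_segment_sq (x - u k) (y - u k) t
  rw [sub_sub_sub_cancel_right] at hseg
  have hκ' := mul_le_mul_of_nonneg_left (hseg ▸ sq_nonneg _ :
    0 ≤ (1 - t) * ‖x - u k‖ ^ 2 + t * ‖y - u k‖ ^ 2 - t * (1 - t) * ‖x - y‖ ^ 2)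
    (div_nonneg hκ two_pos.le)
  linarith

/-! ### Second subderivatives at proximal subgradients -/

theorem secondQuotient_eq_coe {φ : Euc n → EReal} (hφ : Proper φ) {x v u : Euc n} {τ : ℝ}
    (hx : φ x ≠ ⊤) (hu : φ (x + τ • u) ≠ ⊤) :
    secondQuotient φ x v τ u = ((((φ (x + τ • u)).toReal - (φ x).toReal - τ * inner ℝ v u)
      / (1 / 2 * τ ^ 2) : ℝ) : EReal) := by
  rw [secondQuotient, ← hφ.coe_toReal hx, ← hφ.coe_toReal hu, EReal.coe_div, EReal.coe_sub,
    EReal.coe_sub]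
  rfl

theorem le_secondQuotient {φ : Euc n → EReal} (hφ : Proper φ) {x v u : Euc n} {τ r : ℝ}
    (hx : φ x ≠ ⊤) (hτ : 0 < τ) (h : φ (x + τ • u) ≠ ⊤ →
      (φ x).toReal + τ * inner ℝ v u + r * (1 / 2 * τ ^ 2) ≤ (φ (x + τ • u)).toReal) :
    (r : EReal) ≤ secondQuotient φ x v τ u := by
  have hτ2 : 0 < 1 / 2 * τ ^ 2 := by positivity
  by_cases hu : φ (x + τ • u) = ⊤
  · rw [secondQuotient, hu, ← hφ.coe_toReal hx, EReal.top_sub_coe, EReal.top_sub_coe,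
      EReal.top_div_of_pos_ne_top (by exact_mod_cast hτ2) (EReal.coe_ne_top _)]
    exact le_top
  · rw [secondQuotient_eq_coe hφ hx hu, EReal.coe_le_coe_iff, le_div_iff₀ hτ2]
    linarith [h hu]

theorem le_secondSubderivative {φ : Euc n → EReal} {x v w : Euc n} {g : ℝ × Euc n → ℝ} {l : ℝ}
    (hg : Tendsto g (𝓝[>] 0 ×ˢ 𝓝 w) (𝓝 l))
    (h : ∀ τ u, 0 < τ → (g (τ, u) : EReal) ≤ secondQuotient φ x v τ u) :
    (l : EReal) ≤ secondSubderivative φ x v w := by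
  have hg' : Tendsto (fun q => (g q : EReal)) (𝓝[>] 0 ×ˢ 𝓝 w) (𝓝 (l : EReal)) :=
    (continuous_coe_real_ereal.tendsto l).comp hg
  rw [← hg'.liminf_eq]
  refine liminf_le_liminf ?_
  filter_upwards [tendsto_fst.eventually (self_mem_nhdsWithin (a := (0 : ℝ)) (s := Set.Ioi 0))]
    with q hq using h q.1 q.2 hq

theorem secondSubderivative_le_liminf {φ : Euc n → EReal} {x v w : Euc n} {ι : Type*}
    {l : Filter ι} {τ : ι → ℝ} {u : ι → Euc n} (hτ : Tendsto τ l (𝓝[>] 0))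
    (hu : Tendsto u l (𝓝 w)) :
    secondSubderivative φ x v w ≤ liminf (fun k => secondQuotient φ x v (τ k) (u k)) l :=
  liminf_le_liminf_of_le (hτ.prodMk hu)

theorem HasQuadraticMinorant.le_secondSubderivative {φ : Euc n → EReal} (hφ : Proper φ) {σ : ℝ}
    {x v : Euc n} (h : HasQuadraticMinorant σ φ x v) (w : Euc n) :
    ((σ * ‖w‖ ^ 2 : ℝ) : EReal) ≤ secondSubderivative φ x v w := by
  have hg : Tendsto (fun q : ℝ × Euc n => σ * ‖q.2‖ ^ 2) (𝓝[>] 0 ×ˢ 𝓝 w)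
      (𝓝 (σ * ‖w‖ ^ 2)) := (tendsto_snd.norm.pow 2).const_mul σ
  refine VarAnalysis.le_secondSubderivative hg fun τ u hτ =>
    le_secondQuotient hφ h.1 hτ fun hu => ?_
  have := h.2 _ hu
  rw [add_sub_cancel_left, real_inner_smul_right, norm_smul, mul_pow, Real.norm_eq_abs,
    sq_abs] at this
  linarith

namespace IsProxMap

variable {φ : Euc n → EReal} {α : ℝ} {p : Euc n → Euc n} {P : Euc n →L[ℝ] Euc n} {z : Euc n}

/-- Fenchel–Young at `z + τ h` bounds the quotient of `φ` at `u` below by `2⟨h, u⟩ - α‖u‖²` minus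
the quotient of the conjugate at `h`. The direction `h` stays free. -/
theorem le_secondSubderivative (hφ : Proper φ) (hp : IsProxMap φ α p) (hP : HasFDerivAt p P z)
    (h w : Euc n) :
    ((2 * inner ℝ h w - α * ‖w‖ ^ 2 - inner ℝ (P h) h : ℝ) : EReal) ≤
      secondSubderivative φ (p z) (z - α • p z) w := by
  have hg : Tendsto (fun q : ℝ × Euc n => 2 * inner ℝ h q.2 - α * ‖q.2‖ ^ 2
      - (proxConjugate φ α p (z + q.1 • h) - proxConjugate φ α p z
        - q.1 * inner ℝ (p z) h) / (1 / 2 * q.1 ^ 2)) (𝓝[>] 0 ×ˢ 𝓝 w)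
      (𝓝 (2 * inner ℝ h w - α * ‖w‖ ^ 2 - inner ℝ (P h) h)) := by
    have hsnd : Tendsto (fun q : ℝ × Euc n => q.2) (𝓝[>] 0 ×ˢ 𝓝 w) (𝓝 w) := tendsto_snd
    have h1 := ((tendsto_const_nhds (x := h)).inner (𝕜 := ℝ) hsnd).const_mul 2
    have h2 := (hsnd.norm.pow 2).const_mul α
    exact (h1.sub h2).sub ((hp.tendsto_second_quotient hP h).comp tendsto_fst)
  refine VarAnalysis.le_secondSubderivative hg fun τ u hτ =>
    le_secondQuotient hφ (hp z).1 hτ fun hu => ?_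
  have h1 := hp.fenchel_young (z + τ • h) hu
  have h2 := sq_nonneg ‖p z + τ • u - p (z + τ • h)‖
  have hτ2 : 1 / 2 * τ ^ 2 ≠ 0 := by positivity
  simp only [sub_mul, div_mul_cancel₀ _ hτ2]
  have e : proxConjugate φ α p z =
    inner ℝ z (p z) - (φ (p z)).toReal - α / 2 * ‖p z‖ ^ 2 := rfl
  have hid : inner ℝ (z + τ • h) (p z + τ • u) - α / 2 * ‖p z + τ • u‖ ^ 2 =
      τ * inner ℝ (z - α • p z) u + (2 * inner ℝ h u * (1 / 2 * τ ^ 2)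
        - α * ‖u‖ ^ 2 * (1 / 2 * τ ^ 2)) + inner ℝ z (p z) - α / 2 * ‖p z‖ ^ 2
        + τ * inner ℝ (p z) h := by
    simp only [← real_inner_self_eq_norm_sq, inner_sub_left, inner_add_left, inner_add_right,
      real_inner_smul_left, real_inner_smul_right, real_inner_comm u (p z),
      real_inner_comm h (p z)]
    ring
  linarith

/-- Along these directions `p z + τ u = p (z + τ h)` is the maximizer for `z + τ h`, so
Fenchel–Young is an equality and the lower bound with this `h` is attained. -/
theorem tendsto_secondQuotient (hφ : Proper φ) (hp : IsProxMap φ α p) (hP : HasFDerivAt p P z)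
    (h : Euc n) :
    Tendsto (fun τ : ℝ => secondQuotient φ (p z) (z - α • p z) τ (τ⁻¹ • (p (z + τ • h) - p z)))
      (𝓝[>] 0) (𝓝 ((inner ℝ (P h) h - α * ‖P h‖ ^ 2 : ℝ) : EReal)) := by
  have hs := tendsto_slope hP h
  have hlim := (((tendsto_const_nhds (x := h)).inner (𝕜 := ℝ) hs).const_mul 2).sub
    ((hs.norm.pow 2).const_mul α) |>.sub (hp.tendsto_second_quotient hP h)
  have e : 2 * inner ℝ h (P h) - α * ‖P h‖ ^ 2 - inner ℝ (P h) h =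
      inner ℝ (P h) h - α * ‖P h‖ ^ 2 := by
    rw [real_inner_comm h (P h)]; ring
  rw [e] at hlim
  refine ((continuous_coe_real_ereal.tendsto _).comp hlim).congr' ?_
  filter_upwards [self_mem_nhdsWithin] with τ hτ
  have hτ0 : τ ≠ 0 := ne_of_gt hτ
  rw [Function.comp_apply]
  set u := τ⁻¹ • (p (z + τ • h) - p z) with hu
  have hpu : p z + τ • u = p (z + τ • h) := by
    rw [hu, smul_inv_smul₀ hτ0]; abel
  clear_value u
  have hutop : φ (p z + τ • u) ≠ ⊤ := hpu ▸ (hp (z + τ • h)).1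
  rw [secondQuotient_eq_coe hφ (hp z).1 hutop, EReal.coe_eq_coe_iff,
    eq_div_iff (by positivity), sub_mul, div_mul_cancel₀ _ (by positivity)]
  have e : proxConjugate φ α p z =
    inner ℝ z (p z) - (φ (p z)).toReal - α / 2 * ‖p z‖ ^ 2 := rfl
  have e' : proxConjugate φ α p (z + τ • h) = inner ℝ (z + τ • h) (p z + τ • u)
      - (φ (p z + τ • u)).toReal - α / 2 * ‖p z + τ • u‖ ^ 2 := by
    rw [hpu]; rfl
  rw [e, e']
  simp only [← real_inner_self_eq_norm_sq, inner_sub_left, inner_add_left, inner_add_right,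
    real_inner_smul_left, real_inner_smul_right, real_inner_comm u (p z),
    real_inner_comm h (p z)]
  ring

theorem secondSubderivative_apply (hφ : Proper φ) (hp : IsProxMap φ α p)
    (hP : HasFDerivAt p P z) (h : Euc n) :
    secondSubderivative φ (p z) (z - α • p z) (P h) =
      ((inner ℝ (P h) h - α * ‖P h‖ ^ 2 : ℝ) : EReal) := by
  refine le_antisymm ?_ ?_
  · rw [← (hp.tendsto_secondQuotient hφ hP h).liminf_eq]
    exact secondSubderivative_le_liminf tendsto_id (tendsto_slope hP h)
  · convert hp.le_secondSubderivative hφ hP h (P h) using 2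
    rw [real_inner_comm h (P h)]; ring

theorem secondSubderivative_eq_top (hφ : Proper φ) (hp : IsProxMap φ α p)
    (hP : HasFDerivAt p P z) {w : Euc n} (hw : w ∉ P.range) :
    secondSubderivative φ (p z) (z - α • p z) w = ⊤ := by
  -- For `h` orthogonal to the range, the term `⟨P h, h⟩` vanishes, and scaling `h` drives the lower
  -- bound `2⟨h, w⟩ - α‖w‖²` to infinity.
  obtain ⟨h, hh, hhw⟩ : ∃ h ∈ P.rangeᗮ, 0 < inner ℝ h w := by
    have hw' : w ∉ P.rangeᗮᗮ := by rwa [Submodule.orthogonal_orthogonal]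
    rw [Submodule.mem_orthogonal] at hw'
    push Not at hw'
    obtain ⟨h, hh, hne⟩ := hw'
    rcases lt_or_gt_of_ne hne with hlt | hgt
    · exact ⟨-h, Submodule.neg_mem _ hh, by rw [inner_neg_left]; linarith⟩
    · exact ⟨h, hh, hgt⟩
  rw [EReal.eq_top_iff_forall_lt]
  intro r
  obtain ⟨c, hc⟩ := exists_gt ((r + α * ‖w‖ ^ 2) / (2 * inner ℝ h w))
  rw [div_lt_iff₀ (by positivity)] at hc
  refine lt_of_lt_of_le ?_ (hp.le_secondSubderivative hφ hP (c • h) w)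
  have : inner ℝ (P (c • h)) (c • h) = 0 := by
    have h0 : inner ℝ (P (c • h)) h = 0 := (Submodule.mem_orthogonal _ _).1 hh _ ⟨c • h, rfl⟩
    rw [real_inner_smul_right, h0, mul_zero]
  rw [EReal.coe_lt_coe_iff, this, real_inner_smul_left]
  linarith

theorem twiceEpiDifferentiableAt (hφ : Proper φ) (hp : IsProxMap φ α p)
    (hP : HasFDerivAt p P z) : TwiceEpiDifferentiableAt φ (p z) (z - α • p z) := by
  intro w τ hτ0 hτ
  have hτ' : Tendsto τ atTop (𝓝[>] 0) :=
    tendsto_nhdsWithin_iff.2 ⟨hτ, Eventually.of_forall hτ0⟩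
  by_cases hw : w ∈ P.range
  · obtain ⟨h, rfl⟩ := hw
    refine ⟨fun k => (τ k)⁻¹ • (p (z + τ k • h) - p z), (tendsto_slope hP h).comp hτ', ?_⟩
    have := (hp.tendsto_secondQuotient hφ hP h).comp hτ'
    rw [← hp.secondSubderivative_apply hφ hP h] at this
    exact this
  · refine ⟨fun _ => w, tendsto_const_nhds, ?_⟩
    refine tendsto_of_le_liminf_of_limsup_le
      (secondSubderivative_le_liminf hτ' tendsto_const_nhds) ?_
    rw [hp.secondSubderivative_eq_top hφ hP hw]
    exact le_top

theorem isGeneralizedQuadraticForm (hφ : Proper φ) (hp : IsProxMap φ α p)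
    (hP : HasFDerivAt p P z) :
    IsGeneralizedQuadraticForm (secondSubderivative φ (p z) (z - α • p z)) := by
  -- `B` extends a linear right inverse of `P` on its range, so `h = B w` turns the formula at `P h`
  -- into `⟨w, (B - α) w⟩`.
  obtain ⟨g, hg⟩ := (P : Euc n →ₗ[ℝ] Euc n).rangeRestrict.exists_rightInverse_of_surjective
    (LinearMap.range_rangeRestrict _)
  obtain ⟨B, hB⟩ := g.exists_extend
  have hPB : ∀ w ∈ P.range, P (B w) = w := by
    intro w hw
    have h1 : B w = g ⟨w, hw⟩ := LinearMap.congr_fun hB ⟨w, hw⟩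
    have h2 := congrArg Subtype.val (LinearMap.congr_fun hg ⟨w, hw⟩)
    rw [h1]
    exact h2
  set M := Matrix.toEuclideanLin.symm (B - α • LinearMap.id) with hM
  have hMB : Matrix.toEuclideanLin M = B - α • LinearMap.id := by
    rw [hM, LinearEquiv.apply_symm_apply]
  -- `B` depends on the chosen inverse and need not be symmetric; symmetrizing leaves the quadratic
  -- form unchanged.
  refine ⟨(1 / 2 : ℝ) • (M + M.transpose), P.range, ?_, fun w => ?_⟩
  · rw [Matrix.IsSymm, Matrix.transpose_smul, Matrix.transpose_add, Matrix.transpose_transpose,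
      add_comm]
  by_cases hw : w ∈ P.range
  · have h1 : inner ℝ w (((1 / 2 : ℝ) • (M + M.transpose)).toEuclideanLin w) =
        inner ℝ w (M.toEuclideanLin w) := by
      have h2 : M.transpose.toEuclideanLin = LinearMap.adjoint M.toEuclideanLin := by
        rw [← Matrix.toEuclideanLin_conjTranspose_eq_adjoint,
          Matrix.conjTranspose_eq_transpose_of_trivial]
      rw [map_smul, map_add, h2, LinearMap.smul_apply, LinearMap.add_apply, real_inner_smul_right,
        inner_add_right, LinearMap.adjoint_inner_right, real_inner_comm w]
      ring
    have h3 := hp.secondSubderivative_apply hφ hP (B w)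
    rw [hPB w hw] at h3
    rw [h1, hMB, h3, indicatorFun, if_pos (SetLike.mem_coe.2 hw), add_zero,
      LinearMap.sub_apply, LinearMap.smul_apply, LinearMap.id_apply, inner_sub_right,
      real_inner_smul_right, real_inner_self_eq_norm_sq]
  · rw [hp.secondSubderivative_eq_top hφ hP hw, indicatorFun, if_neg (mt SetLike.mem_coe.1 hw),
      EReal.coe_add_top]

end IsProxMap

/-! ### Normal cones and limiting subgradients -/

section Cones

variable {E : Type*} [NormedAddCommGroup E] [InnerProductSpace ℝ E]

/-- A quadratic (proximal) bound on `⟪v, y - z⟫` makes `v` a regular normal. -/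
theorem mem_regularNormalCone_of_inner_le {Ω : Set E} {z v : E} (hz : z ∈ Ω) {C : ℝ}
    (h : ∀ y ∈ Ω, inner ℝ v (y - z) ≤ C * ‖y - z‖ ^ 2) : v ∈ regularNormalCone Ω z := by
  refine ⟨hz, ?_⟩
  have hlim : Tendsto (fun y : E => ((C * ‖y - z‖ : ℝ) : EReal)) (𝓝[Ω \ {z}] z) (𝓝 0) := by
    have : Tendsto (fun y : E => C * ‖y - z‖) (𝓝 z) (𝓝 (C * 0)) :=
      (tendsto_norm_sub_self z).const_mul C
    rw [mul_zero] at this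
    exact ((continuous_coe_real_ereal.tendsto 0).comp this).mono_left nhdsWithin_le_nhds
  rcases eq_or_neBot (𝓝[Ω \ {z}] z) with hbot | hne
  · simp [hbot]
  rw [← hlim.limsup_eq]
  refine limsup_le_limsup ?_
  filter_upwards [self_mem_nhdsWithin] with y hy
  have hpos : 0 < ‖y - z‖ := norm_pos_iff.2 (sub_ne_zero.2 hy.2)
  rw [EReal.coe_le_coe_iff, div_le_iff₀ hpos]
  linarith [h y hy.1]

/-- Regular normals to a set that contains a segment `[z, y]` make an obtuse angle with it. -/
theorem inner_nonpos_of_mem_regularNormalCone {Ω : Set E} {z v y : E}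
    (hv : v ∈ regularNormalCone Ω z)
    (hy : ∀ t : ℝ, 0 < t → t < 1 → (1 - t) • z + t • y ∈ Ω) : inner ℝ v (y - z) ≤ 0 := by
  by_cases hyz : y = z
  · simp [hyz]
  have hpos : 0 < ‖y - z‖ := norm_pos_iff.2 (sub_ne_zero.2 hyz)
  have hpath : Tendsto (fun t : ℝ => (1 - t) • z + t • y) (𝓝[>] 0) (𝓝[Ω \ {z}] z) := by
    rw [tendsto_nhdsWithin_iff]
    constructor
    · have : Continuous fun t : ℝ => (1 - t) • z + t • y := by fun_prop
      have := this.tendsto 0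
      simp only [sub_zero, one_smul, zero_smul, add_zero] at this
      exact this.mono_left nhdsWithin_le_nhds
    · filter_upwards [Ioo_mem_nhdsGT (zero_lt_one' ℝ)] with t ht
      refine ⟨hy t ht.1 ht.2, fun h => ?_⟩
      have h1 : t • (y - z) = 0 := by
        rw [Set.mem_singleton_iff] at h
        rw [← sub_eq_zero.2 h]; module
      rcases smul_eq_zero.1 h1 with h2 | h2
      · exact ht.1.ne' h2
      · exact hyz (sub_eq_zero.1 h2)
  have hle : limsup (fun t : ℝ => ((inner ℝ v ((1 - t) • z + t • y - z) /
      ‖(1 - t) • z + t • y - z‖ : ℝ) : EReal)) (𝓝[>] 0) ≤ 0 :=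
    (limsup_le_limsup_of_le hpath).trans hv.2
  have hconst : Tendsto (fun t : ℝ => ((inner ℝ v ((1 - t) • z + t • y - z) /
      ‖(1 - t) • z + t • y - z‖ : ℝ) : EReal)) (𝓝[>] 0)
      (𝓝 ((inner ℝ v (y - z) / ‖y - z‖ : ℝ) : EReal)) := by
    refine tendsto_const_nhds.congr' ?_
    filter_upwards [self_mem_nhdsWithin] with t ht
    have ht0 : (0 : ℝ) < t := ht
    rw [show (1 - t) • z + t • y - z = t • (y - z) by module, real_inner_smul_right, norm_smul,
      Real.norm_of_nonneg ht0.le, mul_div_mul_left _ _ ht0.ne']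
  rw [hconst.limsup_eq] at hle
  have hle' : inner ℝ v (y - z) / ‖y - z‖ ≤ 0 := by exact_mod_cast hle
  rwa [div_le_iff₀ hpos, zero_mul] at hle'

end Cones

/-- Proximal subgradients are limiting subgradients. -/
theorem HasQuadraticMinorant.mem_limitingSubdifferential {φ : Euc n → EReal} (hφ : Proper φ)
    {σ : ℝ} {x v : Euc n} (h : HasQuadraticMinorant σ φ x v) :
    v ∈ limitingSubdifferential φ x := by
  have hmem : (WithLp.toLp 2 (x, (φ x).toReal) : EucProd n) ∈ epigraph φ :=
    (hφ.coe_toReal h.1).ge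
  refine ⟨lt_top_iff_ne_top.2 h.1, hmem, fun _ => _, fun _ => _, fun _ => hmem,
    tendsto_const_nhds, tendsto_const_nhds, fun _ => ?_⟩
  -- The absolute value covers either sign of `σ` and keeps the vertical contribution to the squared
  -- norm harmless.
  refine mem_regularNormalCone_of_inner_le (C := |σ| / 2) hmem fun y hy => ?_
  have hy' : φ y.fst ≤ (y.snd : EReal) := hy
  have hytop : φ y.fst ≠ ⊤ := ne_top_of_le_ne_top (EReal.coe_ne_top _) hy'
  have hyr : (φ y.fst).toReal ≤ y.snd := by
    rw [← hφ.coe_toReal hytop] at hy'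
    exact_mod_cast hy'
  have h1 := h.2 _ hytop
  rw [WithLp.prod_inner_apply, WithLp.prod_norm_sq_eq_of_L2]
  change inner ℝ v (y.fst - x) + inner ℝ (-1 : ℝ) (y.snd - (φ x).toReal) ≤
    |σ| / 2 * (‖y.fst - x‖ ^ 2 + ‖y.snd - (φ x).toReal‖ ^ 2)
  have h2 : -σ / 2 * ‖y.fst - x‖ ^ 2 ≤ |σ| / 2 * ‖y.fst - x‖ ^ 2 := by
    gcongr; exact neg_le_abs σ
  have h3 : 0 ≤ |σ| / 2 * ‖y.snd - (φ x).toReal‖ ^ 2 := by positivity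
  have h4 : inner ℝ (-1 : ℝ) (y.snd - (φ x).toReal) = -(y.snd - (φ x).toReal) := by
    simp
  rw [h4]
  linarith

/-- Limiting subgradients of an `s`-convex function, `s ≥ 0`, satisfy the subgradient inequality
with modulus `s`. -/
theorem SConvexOn.hasQuadraticMinorant {φ : Euc n → EReal} {s : ℝ} (hs : 0 ≤ s) (hφ : Proper φ)
    (hconv : SConvexOn s Set.univ φ) {x v : Euc n} (hv : v ∈ limitingSubdifferential φ x) :
    HasQuadraticMinorant s φ x v := by
  obtain ⟨hx, -, zk, vk, hzk, hz, hvk, hN⟩ := hv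
  have hx' := hx.ne
  -- Modulus zero first: regular normals at the nearby `zk k` satisfy the inequality because the
  -- epigraph is convex, and it passes to the limit.
  have hsub : ∀ y, φ y ≠ ⊤ → (φ x).toReal + inner ℝ v (y - x) ≤ (φ y).toReal := by
    intro y hy
    have hk : ∀ k, inner ℝ (vk k) (WithLp.toLp 2 (y, (φ y).toReal) - zk k) ≤ 0 := fun k => by
      refine inner_nonpos_of_mem_regularNormalCone (hN k) fun t ht0 ht1 => ?_
      have hzk' : φ (zk k).fst ≤ ((zk k).snd : EReal) := hzk k
      have htop : φ (zk k).fst ≠ ⊤ := ne_top_of_le_ne_top (EReal.coe_ne_top _) hzk'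
      have hr : (φ (zk k).fst).toReal ≤ (zk k).snd := by
        rw [← hφ.coe_toReal htop] at hzk'
        exact_mod_cast hzk'
      obtain ⟨hb, hle⟩ := hconv.toReal_le hφ htop hy ht0 ht1
      have hnn : 0 ≤ s / 2 * t * (1 - t) * ‖(zk k).fst - y‖ ^ 2 := by
        have := sub_nonneg.2 ht1.le
        positivity
      have hr' := mul_le_mul_of_nonneg_left hr (sub_nonneg.2 ht1.le)
      change φ ((1 - t) • (zk k).fst + t • y) ≤
        (((1 - t) * (zk k).snd + t * (φ y).toReal : ℝ) : EReal)
      rw [← hφ.coe_toReal hb, EReal.coe_le_coe_iff]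
      linarith
    have hlim := hvk.inner (𝕜 := ℝ) (hz.const_sub (WithLp.toLp 2 (y, (φ y).toReal)))
    have := le_of_tendsto' hlim hk
    rw [WithLp.prod_inner_apply] at this
    change inner ℝ v (y - x) + inner ℝ (-1 : ℝ) ((φ y).toReal - (φ x).toReal) ≤ 0 at this
    have h4 : inner ℝ (-1 : ℝ) ((φ y).toReal - (φ x).toReal) =
      -((φ y).toReal - (φ x).toReal) := by simp
    rw [h4] at this
    linarith
  refine ⟨hx', fun y hy => ?_⟩
  -- The modulus is recovered by applying `hsub` at `(1 - t) x + t y`, dividing by `t` and letting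
  -- `t ↓ 0`.
  have hlim : Tendsto (fun t : ℝ => (φ x).toReal + inner ℝ v (y - x)
      + s / 2 * (1 - t) * ‖y - x‖ ^ 2) (𝓝[>] 0)
      (𝓝 ((φ x).toReal + inner ℝ v (y - x) + s / 2 * (1 - 0) * ‖y - x‖ ^ 2)) :=
    Tendsto.mono_left (Continuous.tendsto (by fun_prop) 0) nhdsWithin_le_nhds
  rw [sub_zero, mul_one] at hlim
  refine le_of_tendsto hlim ?_
  filter_upwards [Ioo_mem_nhdsGT (zero_lt_one' ℝ)] with t ht
  obtain ⟨hb, hle⟩ := hconv.toReal_le hφ hx' hy ht.1 ht.2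
  have h1 := (hsub _ hb).trans hle
  rw [show (1 - t) • x + t • y - x = t • (y - x) by module, real_inner_smul_right,
    norm_sub_rev] at h1
  refine le_of_mul_le_mul_left (a := t) ?_ ht.1
  linarith

/-! ### Strong convexity from generalized twice differentiability -/

/-- A weakly convex function whose second subderivatives are bounded below by `κ ‖·‖²` wherever it
is generalized twice differentiable is strongly convex with modulus `κ`. -/
theorem stronglyConvex_of_le_secondSubderivative {φ : Euc n → EReal} (hφ : Proper φ)
    (hlsc : LowerSemicontinuous φ) (hweak : WeaklyConvex φ) {κ : ℝ} (hκ : 0 < κ)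
    (h : ∀ w x v : Euc n, v ∈ limitingSubdifferential φ x →
      GeneralizedTwiceDifferentiableAt φ x v →
      ((κ * ‖w‖ ^ 2 : ℝ) : EReal) ≤ secondSubderivative φ x v w) :
    StronglyConvex κ φ := by
  obtain ⟨ρ, hρ, hconv⟩ := hweak
  set α := ρ + 1 with hα
  have hρα : -ρ = 1 - α := by rw [hα]; ring
  choose p hp using fun z => hconv.exists_hasQuadraticMinorant hφ hlsc (α := α)
    (by rw [hα]; linarith) z
  rw [hρα] at hp
  have hp : IsProxMap φ α p := hp
  have hακ : 0 < α + κ := by linarith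
  have hder : ∀ᵐ z, ∃ P : Euc n →L[ℝ] Euc n, HasFDerivAt p P z ∧
      ∀ h, inner ℝ (P h) h ≤ 1 / (α + κ) * ‖h‖ ^ 2 := by
    filter_upwards [hp.lipschitzWith.ae_differentiableAt] with z hz
    refine ⟨_, hz.hasFDerivAt, fun u => ?_⟩
    set P := fderiv ℝ p z
    have hP : HasFDerivAt p P z := hz.hasFDerivAt
    have h1 := h (P u) (p z) (z - α • p z) ((hp z).mem_limitingSubdifferential hφ)
      ⟨hp.twiceEpiDifferentiableAt hφ hP, hp.isGeneralizedQuadraticForm hφ hP⟩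
    rw [hp.secondSubderivative_apply hφ hP, EReal.coe_le_coe_iff] at h1
    rw [one_div, inv_mul_eq_div, le_div_iff₀ hακ]
    have h2 := real_inner_le_norm (P u) u
    -- With `a = (α + κ)‖P u‖`, the previous bounds give `a‖P u‖ ≤ ⟨P u, u⟩ ≤ ‖P u‖‖u‖`; the square
    -- `(a - ‖u‖)²` is the hint for concluding `(α + κ)⟨P u, u⟩ ≤ ‖u‖²`.
    nlinarith [sq_nonneg ((α + κ) * ‖P u‖ - ‖u‖)]
  refine hconv.of_hasQuadraticMinorant hφ hlsc hκ.le fun x v hxv => ?_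
  rw [hρα] at hxv
  have hx := hp.eq_of_hasQuadraticMinorant hxv
  -- With `c = 1 / (α + κ)` the resulting curvature is `1 / c - α = κ`.
  have := hp.hasQuadraticMinorant_of_proxConjugate_le (c := 1 / (α + κ)) (by positivity)
    (hp.proxConjugate_add_le hder) (v + α • x)
  rwa [hx, add_sub_cancel_right, one_div_one_div, add_sub_cancel_left] at this

end VarAnalysis

end

theorem mainTheorem7 (n : ℕ) (φ : VarAnalysis.Euc n → EReal)
    (hproper : VarAnalysis.Proper φ) (hlsc : LowerSemicontinuous φ)
    (hweak : VarAnalysis.WeaklyConvex φ) (κ : ℝ) (hκ : 0 < κ) :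
    List.TFAE [
      VarAnalysis.StronglyConvex κ φ,
      ∀ w x v : VarAnalysis.Euc n, v ∈ VarAnalysis.limitingSubdifferential φ x →
        ((κ * ‖w‖ ^ 2 : ℝ) : EReal) ≤ VarAnalysis.secondSubderivative φ x v w,
      ∀ w x v : VarAnalysis.Euc n, v ∈ VarAnalysis.limitingSubdifferential φ x →
        VarAnalysis.TwiceEpiDifferentiableAt φ x v →
        ((κ * ‖w‖ ^ 2 : ℝ) : EReal) ≤ VarAnalysis.secondSubderivative φ x v w,
      ∀ w x v : VarAnalysis.Euc n, v ∈ VarAnalysis.limitingSubdifferential φ x →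
        VarAnalysis.GeneralizedTwiceDifferentiableAt φ x v →
        ((κ * ‖w‖ ^ 2 : ℝ) : EReal) ≤ VarAnalysis.secondSubderivative φ x v w] := by
  tfae_have 1 → 2 := fun h w _ _ hv =>
    (VarAnalysis.SConvexOn.hasQuadraticMinorant hκ.le hproper h hv).le_secondSubderivative
      hproper w
  tfae_have 2 → 3 := fun h w x v hv _ => h w x v hv
  tfae_have 3 → 4 := fun h w x v hv hd => h w x v hv hd.1
  tfae_have 4 → 1 := fun h =>
    VarAnalysis.stronglyConvex_of_le_secondSubderivative hproper hlsc hweak hκ h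
  tfae_finish
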